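/- Let $G=K_N$ be the complete graph on a vertex set $V$ with $N\ge 1$ elements, let $L$ be its Laplacian matrix (degree matrix minus adjacency matrix), and let $L^\dagger$ be the Moore–Penrose pseudo-inverse of $L$. The biharmonic distance of $j,k\in V$ is $d_B(j,k)=\sqrt{(L^\dagger)^2_{jj}+(L^\dagger)^2_{kk}-2(L^\dagger)^2_{jk}}$. Consider the noisy second-order consensus dynamics $$\dot x_1(t)=x_2(t),\qquad \dot x_2(t)=-Lx_1(t)-Lx_2(t)+w(t),\qquad t\ge 0,$$ with $x_1(t),x_2(t)\in\mathbb{R}^V$, where $w$ is an $N$-vector of uncorrelated standard Gaussian white noise processes; that is, for a vector $W$ of $N$ independent standard Brownian motions and almost every path, $x_1,x_2$ are continuous and, for all $t\ge0$, $x_1(t)=x_1(0)+\int_0^t x_2(s)\,ds$ and $x_2(t)=x_2(0)-\int_0^t (Lx_1(s)+Lx_2(s))\,ds+W(t)$. The initial state $(x_1(0),x_2(0))$ is any square-integrable random vector. Write $\bar x_1(t)=\frac1N\sum_{k\in V}x_{1k}(t)$ and $$H_{SO}(j,k)=\lim_{t\to\infty}\mathbb{E}\big[(x_{1j}(t)-x_{1k}(t))^2\big],\qquad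 H_{SO}(j)=\lim_{t\to\infty}\mathbb{E}\big[(x_{1j}(t)-\bar x_1(t))^2\big],\qquad H_{SO}(G)=\lim_{t\to\infty}\sum_{j\in V}\mathbb{E}\big[(x_{1j}(t)-\bar x_1(t))^2\big].$$ Then $d_B(j,k)=\sqrt2/N$ for all $j\ne k$ in $V$. Moreover, for every such solution, all these expectations are finite, the limits exist, and $$H_{SO}(j,k)=\frac1{N^2}\quad (j,k\in V,\ j\neq k),\qquad H_{SO}(j)=\frac{N-1}{2N^3}\quad (j\in V),\qquad H_{SO}(G)=\frac{N-1}{2N^2}.$$ -/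

import Mathlib

open MeasureTheory ProbabilityTheory Filter Topology
open scoped NNReal Matrix

namespace SecondOrderConsensus

noncomputable section

/-- The Moore–Penrose pseudo-inverse of a real symmetric matrix `A = U Λ Uᵀ`, namely
`U Λ† Uᵀ`, where `Λ†` inverts the nonzero eigenvalues and keeps the zero ones
(in Lean `0⁻¹ = 0`). -/
def pinv {V : Type*} [Fintype V] [DecidableEq V] {A : Matrix V V ℝ} (hA : A.IsHermitian) :
    Matrix V V ℝ :=
  (hA.eigenvectorUnitary : Matrix V V ℝ) * Matrix.diagonal (fun i => (hA.eigenvalues i)⁻¹) *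
    (hA.eigenvectorUnitary : Matrix V V ℝ)ᵀ

section penrose

variable {V : Type*} [Fintype V] [DecidableEq V] {A : Matrix V V ℝ} (hA : A.IsHermitian)

theorem transpose_mul_eigenvectorUnitary :
    (hA.eigenvectorUnitary : Matrix V V ℝ)ᵀ * (hA.eigenvectorUnitary : Matrix V V ℝ) = 1 := by
  have h := (Matrix.mem_unitaryGroup_iff').1 hA.eigenvectorUnitary.2
  simpa [Matrix.star_eq_conjTranspose] using h

theorem eq_mul_diagonal_mul :
    A = (hA.eigenvectorUnitary : Matrix V V ℝ) * Matrix.diagonal hA.eigenvalues *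
      (hA.eigenvectorUnitary : Matrix V V ℝ)ᵀ := by
  have h := hA.spectral_theorem
  simpa [Unitary.conjStarAlgAut_apply, Matrix.star_eq_conjTranspose, Function.comp_def] using h

/-- The four Penrose identities, which characterize the pseudo-inverse. -/
theorem pinv_penrose :
    A * pinv hA * A = A ∧ pinv hA * A * pinv hA = pinv hA ∧
      (A * pinv hA)ᵀ = A * pinv hA ∧ (pinv hA * A)ᵀ = pinv hA * A := by
  have hU := transpose_mul_eigenvectorUnitary hA
  have hS := eq_mul_diagonal_mul hA
  have hP : pinv hA = (hA.eigenvectorUnitary : Matrix V V ℝ) *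
    Matrix.diagonal (fun i => (hA.eigenvalues i)⁻¹) *
    (hA.eigenvectorUnitary : Matrix V V ℝ)ᵀ := rfl
  generalize pinv hA = X at *
  generalize (hA.eigenvectorUnitary : Matrix V V ℝ) = U at *
  generalize hA.eigenvalues = l at *
  have key : ∀ d e : V → ℝ, (U * Matrix.diagonal d * Uᵀ) * (U * Matrix.diagonal e * Uᵀ) =
      U * Matrix.diagonal (fun i => d i * e i) * Uᵀ := by
    intro d e
    calc _ = U * Matrix.diagonal d * (Uᵀ * U) * Matrix.diagonal e * Uᵀ := by
          simp only [Matrix.mul_assoc]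
      _ = _ := by
          rw [hU, Matrix.mul_one, Matrix.mul_assoc U, Matrix.diagonal_mul_diagonal]
  have hT : ∀ d : V → ℝ, (U * Matrix.diagonal d * Uᵀ)ᵀ = U * Matrix.diagonal d * Uᵀ := by
    intro d
    simp [Matrix.transpose_mul, Matrix.mul_assoc]
  subst hP
  rw [hS]
  simp only [key, hT, mul_inv_mul_cancel, and_true, true_and]
  have h : ∀ a : ℝ, a⁻¹ * a * a⁻¹ = a⁻¹ := fun a => by
    simpa using mul_inv_mul_cancel a⁻¹
  simp only [h]

end penrose

/-- The biharmonic distance `d_B(j,k)` of a graph with Laplacian matrix `L`: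
`d_B(j,k)² = (L†)²_{jj} + (L†)²_{kk} - 2 (L†)²_{jk}`. -/
def biharmonicDist {V : Type*} [Fintype V] [DecidableEq V] (G : SimpleGraph V)
    [DecidableRel G.Adj] (j k : V) : ℝ :=
  let X : Matrix V V ℝ := pinv (G.isHermitian_lapMatrix ℝ) ^ 2
  Real.sqrt (X j j + X k k - 2 * X j k)

/-- The noisy second-order consensus dynamics
`ẋ₁ = x₂`, `ẋ₂ = -L x₁ - L x₂ + w`
on a graph with Laplacian matrix `L`. The vector `w` of uncorrelated Gaussian white noise processes
is the formal derivative of a vector `W` of independent standard Brownian motions, so the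
equation is the integral equation below, which holds along almost every path.
The initial state is an arbitrary square-integrable random vector. -/
structure IsConsensusSolution {V : Type*} [Fintype V] [DecidableEq V] (G : SimpleGraph V)
    [DecidableRel G.Adj] {Ω : Type*} [MeasurableSpace Ω] (P : Measure Ω)
    (W : V → ℝ≥0 → Ω → ℝ) (x₁ x₂ : ℝ≥0 → Ω → V → ℝ) : Prop where
  brownian : ∀ j, IsBrownianReal (W j) P
  indep : iIndepFun (fun j ω t => W j t ω) P
  memLp_init₁ : ∀ j, MemLp (fun ω => x₁ 0 ω j) 2 P
  memLp_init₂ : ∀ j, MemLp (fun ω => x₂ 0 ω j) 2 P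
  continuous₁ : ∀ᵐ ω ∂P, Continuous (fun t => x₁ t ω)
  continuous₂ : ∀ᵐ ω ∂P, Continuous (fun t => x₂ t ω)
  eq₁ : ∀ᵐ ω ∂P, ∀ (t : ℝ≥0) (j : V),
    x₁ t ω j = x₁ 0 ω j + ∫ s in (0 : ℝ)..t, x₂ s.toNNReal ω j
  eq₂ : ∀ᵐ ω ∂P, ∀ (t : ℝ≥0) (j : V),
    x₂ t ω j = x₂ 0 ω j
      + (∫ s in (0 : ℝ)..t,
          (-(G.lapMatrix ℝ *ᵥ x₁ s.toNNReal ω) j - (G.lapMatrix ℝ *ᵥ x₂ s.toNNReal ω) j))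
      + W j t ω

/-- The average `x̄ = (1/N) ∑ₖ xₖ` of a vector of vertex states. -/
def avg {V : Type*} [Fintype V] (x : V → ℝ) : ℝ :=
  (1 / (Fintype.card V : ℝ)) * ∑ k, x k

/-- `H_SO(j,k)` exists and equals `h`:
`h = lim_{t → ∞} 𝔼[(x₁ⱼ(t) - x₁ₖ(t))²]`, all the expectations being finite. -/
def HasPairwiseVariance {V Ω : Type*} [MeasurableSpace Ω] (P : Measure Ω)
    (x₁ : ℝ≥0 → Ω → V → ℝ) (j k : V) (h : ℝ) : Prop :=
  (∀ t, Integrable (fun ω => (x₁ t ω j - x₁ t ω k) ^ 2) P) ∧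
    Tendsto (fun t => ∫ ω, (x₁ t ω j - x₁ t ω k) ^ 2 ∂P) atTop (𝓝 h)

/-- `H_SO(j)` exists and equals `h`:
`h = lim_{t → ∞} 𝔼[(x₁ⱼ(t) - x̄₁(t))²]`, all the expectations being finite. -/
def HasVertexVariance {V Ω : Type*} [Fintype V] [MeasurableSpace Ω] (P : Measure Ω)
    (x₁ : ℝ≥0 → Ω → V → ℝ) (j : V) (h : ℝ) : Prop :=
  (∀ t, Integrable (fun ω => (x₁ t ω j - avg (x₁ t ω)) ^ 2) P) ∧
    Tendsto (fun t => ∫ ω, (x₁ t ω j - avg (x₁ t ω)) ^ 2 ∂P) atTop (𝓝 h)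

/-- `H_SO(G)` exists and equals `h`:
`h = lim_{t → ∞} ∑ⱼ 𝔼[(x₁ⱼ(t) - x̄₁(t))²]`, all the expectations being finite. -/
def HasTotalVariance {V Ω : Type*} [Fintype V] [MeasurableSpace Ω] (P : Measure Ω)
    (x₁ : ℝ≥0 → Ω → V → ℝ) (h : ℝ) : Prop :=
  (∀ t j, Integrable (fun ω => (x₁ t ω j - avg (x₁ t ω)) ^ 2) P) ∧
    Tendsto (fun t => ∑ j, ∫ ω, (x₁ t ω j - avg (x₁ t ω)) ^ 2 ∂P) atTop (𝓝 h)

end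

end SecondOrderConsensus

namespace SecondOrderConsensus

/-! If `c : V → ℝ` has zero sum, then `c` is an eigenvector of the Laplacian of the complete graph
with eigenvalue `N`. Hence `u = ∑ c j * x₁ j` and `v = ∑ c j * x₂ j` decouple from the other modes:
they solve the scalar oscillator `u' = v`, `v' = -N u - N v + noise`, where the noise is the
derivative of `B = ∑ c j * W j`, a process with covariance `|c|² min s r`. Every quantity in the
theorem is the second moment of such an observable, or a sum of them, so all limits follow from the
scalar one, `|c|² / (2 N²)` (`tendsto_secondMoment_oscillator`).

No stochastic integral is needed. Integrating by parts in the variation of constants formula gives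
the pathwise identity `u t = g t * v₀ + (g' t + κ g t) * u₀ + ∫ g' (t - s) * B s`, where `g` is the
impulse response (`eq_of_integral_eq`). Fubini turns the second moment of the last term into `|c|²
∫₀ᵗ g²` (`memLp_integral_mul_and_secondMoment`). Quadratic forms in `(g, g')` show that `g` and `g'`
decay and that `∫₀^∞ g² = 1 / (2 κ²)`.

The biharmonic distance is pure algebra: `L² = N L` makes `L / N²` satisfy the Penrose identities.
-/

/-! ### The impulse response of the damped oscillator. -/

/-- `g` is the impulse response of the damped oscillator `y'' + κ y' + κ y = 0`,
and `g'` is its derivative. -/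
structure IsImpulseResponse (κ : ℝ) (g g' : ℝ → ℝ) : Prop where
  zero : g 0 = 0
  deriv_zero : g' 0 = 1
  hasDerivAt : ∀ t, HasDerivAt g (g' t) t
  hasDerivAt_deriv : ∀ t, HasDerivAt g' (-κ * g' t - κ * g t) t

/-- The exponential of the companion operator avoids splitting on the sign of the discriminant `κ² -
4κ`. -/
theorem exists_isImpulseResponse (κ : ℝ) : ∃ g g', IsImpulseResponse κ g g' := by
  let A : (ℝ × ℝ) →L[ℝ] (ℝ × ℝ) :=
    (ContinuousLinearMap.snd ℝ ℝ ℝ).prod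
      (-κ • ContinuousLinearMap.snd ℝ ℝ ℝ - κ • ContinuousLinearMap.fst ℝ ℝ ℝ)
  let y : ℝ → ℝ × ℝ := fun t => NormedSpace.exp (t • A) (0, 1)
  have hy : ∀ t, HasDerivAt y (A (y t)) t := fun t => by
    have h := (hasDerivAt_exp_smul_const' (𝕂 := ℝ) A t).clm_apply
      (hasDerivAt_const t ((0, 1) : ℝ × ℝ))
    simpa [y] using h
  have h0 : y 0 = (0, 1) := by simp [y]
  refine ⟨fun t => (y t).1, fun t => (y t).2, by simp [h0], by simp [h0], fun t => ?_, fun t => ?_⟩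
  · exact (hy t).fst
  · exact (hy t).snd

namespace IsImpulseResponse

variable {κ : ℝ} {g g' : ℝ → ℝ} (h : IsImpulseResponse κ g g')
include h

theorem continuous : Continuous g :=
  continuous_iff_continuousAt.2 fun t => (h.hasDerivAt t).continuousAt

theorem continuous_deriv : Continuous g' :=
  continuous_iff_continuousAt.2 fun t => (h.hasDerivAt_deriv t).continuousAt

/-- The derivative of a quadratic form along the solution. -/
theorem hasDerivAt_quadratic (a b c t : ℝ) :
    HasDerivAt (fun t => a * g t ^ 2 + b * (g t * g' t) + c * g' t ^ 2)
      (-(b * κ) * g t ^ 2 + (2 * a - b * κ - 2 * c * κ) * (g t * g' t)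
        + (b - 2 * c * κ) * g' t ^ 2) t := by
  have h1 := h.hasDerivAt t
  have h2 := h.hasDerivAt_deriv t
  refine ((((h1.pow 2).const_mul a).add ((h1.mul h2).const_mul b)).add
    ((h2.pow 2).const_mul c)).congr_deriv ?_
  push_cast
  ring

/-- A Lyapunov function: a positive definite quadratic form `E` with `E' = -(g² + g'²)` is
comparable to `g² + g'²`, hence decays exponentially. -/
theorem tendsto_sq_add_sq (hκ : 0 < κ) :
    Tendsto (fun t => g t ^ 2 + g' t ^ 2) atTop (𝓝 0) := by
  -- These solve the linear system `bκ = 1`, `2a - bκ - 2cκ = 0`, `b - 2cκ = -1`.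
  set a : ℝ := 1 + 1 / (2 * κ) with ha
  set b : ℝ := 1 / κ with hb
  set c : ℝ := (1 + 1 / κ) / (2 * κ) with hc
  set E : ℝ → ℝ := fun t => a * g t ^ 2 + b * (g t * g' t) + c * g' t ^ 2 with hE
  have hE' : ∀ t, HasDerivAt E (-(g t ^ 2 + g' t ^ 2)) t := fun t => by
    refine (h.hasDerivAt_quadratic a b c t).congr_deriv ?_
    simp only [ha, hb, hc]
    field_simp
    ring
  have hb0 : 0 < b := by positivity
  have hup : ∀ t, E t ≤ (a + b + c) * (g t ^ 2 + g' t ^ 2) := fun t => by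
    have ha0 : 0 < a := by positivity
    have hc0 : 0 < c := by positivity
    simp only [hE]
    nlinarith [mul_nonneg hb0.le (sq_nonneg (g t - g' t)), mul_nonneg ha0.le (sq_nonneg (g' t)),
      mul_nonneg hc0.le (sq_nonneg (g t)), mul_nonneg hb0.le (sq_nonneg (g t)),
      mul_nonneg hb0.le (sq_nonneg (g' t))]
  have ha' : a = 1 + b / 2 := by simp only [ha, hb]; field_simp
  have hc' : c = b / 2 + b ^ 2 / 2 := by simp only [hc, hb]; field_simp
  have hlow : ∃ m > 0, ∀ t, m * (g t ^ 2 + g' t ^ 2) ≤ E t := by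
    -- With `m = b / 2` the difference of the two sides is `((g + b g')² + g²) / 2`.
    refine ⟨b / 2, by positivity, fun t => ?_⟩
    simp only [hE, ha', hc']
    nlinarith [sq_nonneg (g t + b * g' t), sq_nonneg (g t)]
  obtain ⟨m, hm, hlow⟩ := hlow
  set C := a + b + c
  have hC : 0 < C := by positivity
  -- Grönwall: `E ≤ C (g² + g'²)` gives `E' ≤ -E / C`.
  have hanti : AntitoneOn (fun t => Real.exp (t / C) * E t) (Set.Ici 0) := by
    have hd : ∀ t, HasDerivAt (fun t => Real.exp (t / C) * E t)
        (Real.exp (t / C) * (1 / C) * E t + Real.exp (t / C) * (-(g t ^ 2 + g' t ^ 2))) t :=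
      fun t => (((hasDerivAt_id t).div_const C).exp).mul (hE' t)
    refine (antitone_of_hasDerivAt_nonpos hd fun t => ?_).antitoneOn _
    have h1 : E t / C ≤ g t ^ 2 + g' t ^ 2 := by
      rw [div_le_iff₀ hC, mul_comm]; exact hup t
    have h2 := Real.exp_pos (t / C)
    have : Real.exp (t / C) * (1 / C) * E t + Real.exp (t / C) * (-(g t ^ 2 + g' t ^ 2))
      = Real.exp (t / C) * (E t / C - (g t ^ 2 + g' t ^ 2)) := by ring
    rw [this]
    exact mul_nonpos_of_nonneg_of_nonpos h2.le (by linarith)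
  have hbound : ∀ t, 0 ≤ t → g t ^ 2 + g' t ^ 2 ≤ E 0 / m * Real.exp (-(t / C)) := fun t ht => by
    have h1 := hanti Set.self_mem_Ici ht ht
    simp only [zero_div, Real.exp_zero, one_mul] at h1
    rw [Real.exp_neg, ← div_eq_mul_inv, le_div_iff₀ (Real.exp_pos _), le_div_iff₀ hm]
    calc _ = Real.exp (t / C) * (m * (g t ^ 2 + g' t ^ 2)) := by ring
      _ ≤ Real.exp (t / C) * E t := by gcongr; exact hlow t
      _ ≤ _ := h1
  refine squeeze_zero' (Eventually.of_forall fun t => by positivity)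
    ((eventually_ge_atTop 0).mono hbound) ?_
  have : Tendsto (fun t : ℝ => Real.exp (-(t / C))) atTop (𝓝 0) :=
    Real.tendsto_exp_neg_atTop_nhds_zero.comp (tendsto_id.atTop_div_const hC)
  simpa using this.const_mul (E 0 / m)

theorem tendsto_zero (hκ : 0 < κ) : Tendsto g atTop (𝓝 0) := by
  have : Tendsto (fun t => g t ^ 2) atTop (𝓝 0) :=
    squeeze_zero (fun t => sq_nonneg _) (fun t => by linarith [sq_nonneg (g' t)])
      (h.tendsto_sq_add_sq hκ)
  have h2 := this.sqrt
  simp only [Real.sqrt_sq_eq_abs, Real.sqrt_zero] at h2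
  exact (tendsto_zero_iff_abs_tendsto_zero _).2 h2

theorem tendsto_deriv_zero (hκ : 0 < κ) : Tendsto g' atTop (𝓝 0) := by
  have : Tendsto (fun t => g' t ^ 2) atTop (𝓝 0) :=
    squeeze_zero (fun t => sq_nonneg _) (fun t => by linarith [sq_nonneg (g t)])
      (h.tendsto_sq_add_sq hκ)
  have h2 := this.sqrt
  simp only [Real.sqrt_sq_eq_abs, Real.sqrt_zero] at h2
  exact (tendsto_zero_iff_abs_tendsto_zero _).2 h2

theorem tendsto_integral_sq (hκ : 0 < κ) :
    Tendsto (fun t => ∫ s in (0 : ℝ)..t, g s ^ 2) atTop (𝓝 (1 / (2 * κ ^ 2))) := by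
  -- Chosen so that the quadratic form has derivative exactly `-g²`; its value at time zero is `c`,
  -- which becomes the limit.
  set a : ℝ := (1 + 1 / κ) / 2 with ha
  set b : ℝ := 1 / κ with hb
  set c : ℝ := 1 / (2 * κ ^ 2) with hc
  have hint : ∀ t, ∫ s in (0 : ℝ)..t, g s ^ 2 =
      c - (a * g t ^ 2 + b * (g t * g' t) + c * g' t ^ 2) := fun t => by
    have := intervalIntegral.integral_eq_sub_of_hasDerivAt (a := 0) (b := t)
      (f := fun t => -(a * g t ^ 2 + b * (g t * g' t) + c * g' t ^ 2)) (f' := fun t => g t ^ 2)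
      (fun s _ => (h.hasDerivAt_quadratic a b c s).neg.congr_deriv (by
        simp only [ha, hb, hc]
        field_simp
        ring)) ((h.continuous.pow 2).intervalIntegrable _ _)
    rw [this, h.zero, h.deriv_zero]
    ring
  simp only [hint]
  have h1 := h.tendsto_zero hκ
  have h2 := h.tendsto_deriv_zero hκ
  simpa using (((h1.pow 2).const_mul a).add ((h1.mul h2).const_mul b)).add
    ((h2.pow 2).const_mul c) |>.const_sub c

/-- The kernel `g'` integrates to `g`. -/
theorem integral_deriv_sub (a t : ℝ) : ∫ s in a..t, g' (t - s) = g (t - a) := by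
  rw [intervalIntegral.integral_comp_sub_left, intervalIntegral.integral_eq_sub_of_hasDerivAt
    (fun s _ => h.hasDerivAt s) (h.continuous_deriv.intervalIntegrable _ _)]
  simp [h.zero]

/-- Variation of constants for the forced damped oscillator in integral form. -/
theorem eq_of_integral_eq {u v B : ℝ → ℝ} {u₀ v₀ : ℝ} (hu : Continuous u) (hv : Continuous v)
    (hu' : ∀ t, 0 ≤ t → u t = u₀ + ∫ s in (0 : ℝ)..t, v s)
    (hv' : ∀ t, 0 ≤ t → v t = v₀ - κ * (∫ s in (0 : ℝ)..t, (u s + v s)) + B t)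
    {t : ℝ} (ht : 0 ≤ t) :
    u t = g t * v₀ + (g' t + κ * g t) * u₀ + ∫ s in (0 : ℝ)..t, g' (t - s) * B s := by
  -- `z` is the differentiable part `v - B` of the velocity; `B` itself need not be differentiable.
  set z : ℝ → ℝ := fun s => v₀ - κ * ∫ s in (0 : ℝ)..s, (u s + v s) with hz
  set y : ℝ → ℝ := fun s => u₀ + ∫ s in (0 : ℝ)..s, v s with hy
  have hz' : ∀ s, HasDerivAt z (-(κ * (u s + v s))) s := fun s =>
    ((((hu.add hv).integral_hasStrictDerivAt 0 s).hasDerivAt.const_mul κ).const_sub v₀)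
  have hy' : ∀ s, HasDerivAt y (v s) s := fun s =>
    ((hv.integral_hasStrictDerivAt 0 s).hasDerivAt.const_add u₀)
  have hg : ∀ s, HasDerivAt (fun s => g (t - s)) (-g' (t - s)) s := fun s => by
    simpa using (h.hasDerivAt (t - s)).comp_const_sub t s
  have hg' : ∀ s, HasDerivAt (fun s => g' (t - s)) (-(-κ * g' (t - s) - κ * g (t - s))) s :=
    fun s => by simpa using (h.hasDerivAt_deriv (t - s)).comp_const_sub t s
  have hB : ∀ s ∈ Set.uIcc 0 t, B s = v s - z s := fun s hs => by
    rw [Set.uIcc_of_le ht] at hs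
    rw [hv' s hs.1]; simp [hz]
  have hyc : Continuous z := continuous_iff_continuousAt.2 fun s => (hz' s).continuousAt
  -- For `B = 0` the function below would be constant in `s`, being the solution at time `t`
  -- restarted from time `s`; in general its derivative is `g' (t - s) * B s`.
  have key := intervalIntegral.integral_eq_sub_of_hasDerivAt (a := 0) (b := t)
    (f := fun s => g (t - s) * z s + (g' (t - s) + κ * g (t - s)) * y s)
    (f' := fun s => g' (t - s) * (v s - z s))
    (fun s hs => (((hg s).mul (hz' s)).add (((hg' s).add ((hg s).const_mul κ)).mul
      (hy' s))).congr_deriv (by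
        rw [Set.uIcc_of_le ht] at hs
        have : y s = u s := (hu' s hs.1).symm
        simp only [Pi.add_apply, this]
        ring))
    (((h.continuous_deriv.comp (by fun_prop)).mul (hv.sub hyc)).intervalIntegrable _ _)
  rw [intervalIntegral.integral_congr (g := fun s => g' (t - s) * (v s - z s))
    (fun s hs => by simp only [hB s hs]), key, hu' t ht]
  simp [h.zero, h.deriv_zero, hy, hz]

end IsImpulseResponse

/-! ### Second moments of integrals of random processes. -/

section SecondMoment

/-- The second moment of an integral of a random field, in terms of its covariance kernel. -/
theorem memLp_integral_and_secondMoment {S Ω : Type*} [MeasurableSpace S] [MeasurableSpace Ω]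
    {μ : Measure S} [IsFiniteMeasure μ] {Q : Measure Ω} [SFinite Q] {k : S → Ω → ℝ}
    (hk : Measurable (Function.uncurry k))
    (hk2 : Integrable (fun p : S × Ω => k p.1 p.2 ^ 2) (μ.prod Q)) :
    MemLp (fun ω => ∫ s, k s ω ∂μ) 2 Q ∧
      ∫ ω, (∫ s, k s ω ∂μ) ^ 2 ∂Q = ∫ p : S × S, ∫ ω, k p.1 ω * k p.2 ω ∂Q ∂(μ.prod μ) := by
  have h1 : Integrable (fun p : Ω × S × S => k p.2.1 p.1 ^ 2) (Q.prod (μ.prod μ)) :=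
    (measurePreserving_prodAssoc Q μ μ).symm.integrable_comp_of_integrable
      (hk2.swap.comp_fst μ)
  have h2 : Integrable (fun p : Ω × S × S => k p.2.2 p.1 ^ 2) (Q.prod (μ.prod μ)) :=
    ((MeasurePreserving.id Q).prod (Measure.measurePreserving_swap (μ := μ)
      (ν := μ))).integrable_comp_of_integrable h1
  -- Fubini is justified by `|k s * k r| ≤ k s ² + k r ²`.
  have hF : Integrable (Function.uncurry fun (ω : Ω) (p : S × S) => k p.1 ω * k p.2 ω)
      (Q.prod (μ.prod μ)) := by
    refine (h1.add h2).mono' ?_ (Eventually.of_forall fun p => ?_)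
    · exact ((hk.comp (by fun_prop : Measurable fun p : Ω × S × S => (p.2.1, p.1))).mul
        (hk.comp (by fun_prop : Measurable fun p : Ω × S × S => (p.2.2, p.1)))).aestronglyMeasurable
    · simp only [Function.uncurry, Real.norm_eq_abs, abs_mul, Pi.add_apply]
      nlinarith [sq_abs (k p.2.1 p.1), sq_abs (k p.2.2 p.1),
        sq_nonneg (|k p.2.1 p.1| - |k p.2.2 p.1|), sq_nonneg (k p.2.1 p.1),
        sq_nonneg (k p.2.2 p.1)]
  have hsq : ∀ ω, (∫ s, k s ω ∂μ) ^ 2 = ∫ p : S × S, k p.1 ω * k p.2 ω ∂(μ.prod μ) := fun ω => by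
    rw [integral_prod_mul (fun s => k s ω) (fun s => k s ω), sq]
  constructor
  · rw [memLp_two_iff_integrable_sq]
    · simpa only [hsq, Function.uncurry] using hF.integral_prod_left
    · exact (hk.comp measurable_swap).aestronglyMeasurable.integral_prod_right'
  · simp only [hsq]
    exact integral_integral_swap hF

/-- The variance of the Wiener-type integral `∫₀ᵗ f(s) b(s) ds` for a process `b` with the
covariance of a multiple of Brownian motion. -/
theorem memLp_integral_mul_and_secondMoment {Ω : Type*} [MeasurableSpace Ω] {P : Measure Ω}
    [IsProbabilityMeasure P] {b : ℝ → Ω → ℝ} (hb : Measurable (Function.uncurry b))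
    (hb2 : ∀ s, MemLp (b s) 2 P) {σ : ℝ}
    (hcov : ∀ s r, 0 ≤ s → 0 ≤ r → ∫ ω, b s ω * b r ω ∂P = σ * min s r)
    {f : ℝ → ℝ} (hf : Continuous f) {t : ℝ} (ht : 0 ≤ t) :
    MemLp (fun ω => ∫ s in (0 : ℝ)..t, f s * b s ω) 2 P ∧
      ∫ ω, (∫ s in (0 : ℝ)..t, f s * b s ω) ^ 2 ∂P =
        σ * ∫ a in (0 : ℝ)..t, (∫ s in a..t, f s) ^ 2 := by
  set μ : Measure ℝ := volume.restrict (Set.Ioc 0 t) with hμ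
  have hmem : ∀ᵐ s ∂μ, s ∈ Set.Ioc 0 t := ae_restrict_mem measurableSet_Ioc
  have hf2 : Integrable (fun s => f s ^ 2) μ := ((hf.pow 2).continuousOn.integrableOn_Icc).mono_set
    Set.Ioc_subset_Icc_self
  have hm1 : Measurable (Function.uncurry fun s ω => f s * b s ω) :=
    (hf.measurable.comp measurable_fst).mul hb
  have hi1 : Integrable (fun p : ℝ × Ω => (f p.1 * b p.1 p.2) ^ 2) (μ.prod P) := by
    refine (integrable_prod_iff (hm1.pow_const 2).aestronglyMeasurable).2 ?_
    constructor
    · exact Eventually.of_forall fun s => ((hb2 s).const_mul (f s)).integrable_sq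
    · have : Integrable (fun s => f s ^ 2 * (σ * s)) μ :=
        ((by fun_prop : Continuous fun s => f s ^ 2 * (σ * s)).continuousOn.integrableOn_Icc).mono_set
          Set.Ioc_subset_Icc_self
      refine this.congr (hmem.mono fun s hs => ?_)
      simp only [Function.uncurry, Real.norm_eq_abs, mul_pow, abs_mul, abs_pow, sq_abs]
      rw [integral_const_mul]
      simp only [sq (b s _)]
      rw [hcov s s hs.1.le hs.1.le, min_self]
  obtain ⟨hL, hE⟩ := memLp_integral_and_secondMoment hm1 hi1
  simp only [intervalIntegral.integral_of_le ht]
  refine ⟨hL, ?_⟩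
  -- Since `min s r` is the measure of `{a > 0 | a < s ∧ a < r}`, the field `q`, with `a` in the
  -- role of the random point, has the same covariance kernel as `f s * b s` up to the factor `σ`.
  -- The previous lemma, applied to both fields, equates their second moments up to `σ`.
  let q : ℝ → ℝ → ℝ := fun s a => f s * (Set.Iio s).indicator (fun _ => (1 : ℝ)) a
  have hm2 : Measurable (Function.uncurry q) := by
    refine (hf.measurable.comp measurable_fst).mul ?_
    have : (fun p : ℝ × ℝ => (Set.Iio p.1).indicator (fun _ => (1 : ℝ)) p.2) =
        {p : ℝ × ℝ | p.2 < p.1}.indicator fun _ => 1 := by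
      ext p; simp [Set.indicator]
    exact this ▸ measurable_const.indicator (measurableSet_lt measurable_snd measurable_fst)
  have hi2 : Integrable (fun p : ℝ × ℝ => q p.1 p.2 ^ 2) (μ.prod μ) := by
    refine (hf2.comp_fst μ).mono' (hm2.pow_const 2).aestronglyMeasurable
      (Eventually.of_forall fun p => ?_)
    simp only [q, Set.indicator, Real.norm_eq_abs]
    split_ifs <;> simp [sq_nonneg]
  have hE2 := (memLp_integral_and_secondMoment hm2 hi2).2
  have hR : ∫ a, (∫ s, q s a ∂μ) ^ 2 ∂μ = ∫ a in Set.Ioc 0 t, (∫ s in a..t, f s) ^ 2 := by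
    refine integral_congr_ae (hmem.mono fun a ha => ?_)
    have : (fun s => q s a) = (Set.Ioi a).indicator f := by
      ext s; simp [q, Set.indicator]
    simp only [this, hμ]
    rw [integral_indicator measurableSet_Ioi, Measure.restrict_restrict measurableSet_Ioi,
      intervalIntegral.integral_of_le ha.2]
    congr 3
    ext s
    simp only [Set.mem_inter_iff, Set.mem_Ioi, Set.mem_Ioc]
    exact ⟨fun h => ⟨h.1, h.2.2⟩, fun h => ⟨h.1, ha.1.trans h.1, h.2⟩⟩
  rw [hE, ← hR, hE2, ← integral_const_mul]
  have hmem2 : ∀ᵐ p ∂(μ.prod μ), p.1 ∈ Set.Ioc 0 t ∧ p.2 ∈ Set.Ioc 0 t := by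
    rw [hμ, Measure.prod_restrict]
    exact (ae_restrict_mem (measurableSet_Ioc.prod measurableSet_Ioc)).mono fun p hp => hp
  refine integral_congr_ae (hmem2.mono fun ⟨s, r⟩ ⟨hs, hr⟩ => ?_)
  simp only at hs hr ⊢
  have e1 : ∀ ω, f s * b s ω * (f r * b r ω) = f s * f r * (b s ω * b r ω) := fun ω => by ring
  have e2 : ∀ a, q s a * q r a = f s * f r * (Set.Iio (min s r)).indicator (fun _ => (1 : ℝ)) a :=
    fun a => by
      simp only [q, Set.indicator, Set.mem_Iio, lt_min_iff]
      split_ifs <;> simp_all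
  simp only [e1, e2, integral_const_mul]
  rw [hcov s r hs.1.le hr.1.le, integral_indicator measurableSet_Iio, hμ,
    Measure.restrict_restrict measurableSet_Iio]
  have : Set.Iio (min s r) ∩ Set.Ioc 0 t = Set.Ioo 0 (min s r) := by
    ext a
    simp only [Set.mem_inter_iff, Set.mem_Iio, Set.mem_Ioc, Set.mem_Ioo]
    exact ⟨fun h => ⟨h.2.1, h.1⟩, fun h => ⟨h.2, h.1, h.2.le.trans ((min_le_left _ _).trans hs.2)⟩⟩
  rw [this]
  simp only [integral_const, MeasurableSet.univ, measureReal_restrict_apply, Set.univ_inter,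
    Real.volume_real_Ioo, sub_zero, smul_eq_mul, mul_one]
  rw [max_eq_left (le_min hs.1.le hr.1.le)]
  ring

end SecondMoment

/-- A process with almost surely continuous paths is indistinguishable from a jointly measurable
one. -/
theorem exists_jointlyMeasurable_modification {Ω : Type*} [MeasurableSpace Ω] {P : Measure Ω}
    {b : ℝ → Ω → ℝ} (hm : ∀ s, AEMeasurable (b s) P) (hc : ∀ᵐ ω ∂P, Continuous fun s => b s ω) :
    ∃ b' : ℝ → Ω → ℝ, Measurable (Function.uncurry b') ∧ ∀ᵐ ω ∂P, ∀ s, b' s ω = b s ω := by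
  classical
  have hgood : ∀ᵐ ω ∂P, Continuous (fun s => b s ω) ∧
      ∀ q : ℚ, b q ω = (hm q).mk (b q) ω :=
    hc.and (ae_all_iff.2 fun q : ℚ => (hm q).ae_eq_mk)
  obtain ⟨T, hT, hTm, hT0⟩ := exists_measurable_superset_of_null (ae_iff.1 hgood)
  have hout : ∀ ω ∉ T, Continuous (fun s => b s ω) ∧ ∀ q : ℚ, b q ω = (hm q).mk (b q) ω :=
    fun ω hω => by
      by_contra hn
      exact hω (hT hn)
  refine ⟨fun s ω => if ω ∈ T then 0 else b s ω, ?_, ?_⟩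
  · refine measurable_uncurry_of_continuous_of_measurable (fun ω => ?_) fun s => ?_
    · by_cases hω : ω ∈ T
      · simpa [hω] using continuous_const
      · simpa [hω] using (hout ω hω).1
    -- Off the null set `T`, the value at `s` is a limit of measurable versions at rational times.
    · obtain ⟨x, -, -, hx⟩ := Real.exists_seq_rat_strictMono_tendsto s
      refine measurable_of_tendsto_metrizable
        (f := fun n ω => if ω ∈ T then 0 else (hm (x n)).mk (b (x n)) ω)
        (fun n => Measurable.ite hTm measurable_const (hm _).measurable_mk)
        (tendsto_pi_nhds.2 fun ω => ?_)
      by_cases hω : ω ∈ T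
      · simp [hω]
      · simp only [hω, if_false, ← (hout ω hω).2]
        exact ((hout ω hω).1.tendsto s).comp hx
  · have : ∀ᵐ ω ∂P, ω ∉ T := by rw [ae_iff]; simpa using hT0
    filter_upwards [this] with ω hω s
    simp [hω]

theorem abs_integral_mul_le {Ω : Type*} [MeasurableSpace Ω] {P : Measure Ω} {X Y : Ω → ℝ}
    (hX : MemLp X 2 P) (hY : MemLp Y 2 P) :
    |∫ ω, X ω * Y ω ∂P| ≤ ∫ ω, X ω ^ 2 ∂P + ∫ ω, Y ω ^ 2 ∂P := by
  rw [← integral_add hX.integrable_sq hY.integrable_sq]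
  refine (abs_integral_le_integral_abs).trans (integral_mono (hX.integrable_mul hY).abs
    (hX.integrable_sq.add hY.integrable_sq) fun ω => ?_)
  simp only [abs_mul]
  nlinarith [sq_abs (X ω), sq_abs (Y ω), sq_nonneg (|X ω| - |Y ω|), sq_nonneg (X ω),
    sq_nonneg (Y ω)]

/-! ### The stationary variance of the scalar oscillator. -/

/-- Stationary variance of the damped oscillator driven by white noise of intensity `σ`. -/
theorem tendsto_secondMoment_oscillator {Ω : Type*} [MeasurableSpace Ω] {P : Measure Ω}
    [IsProbabilityMeasure P] {κ σ : ℝ} (hκ : 0 < κ) {b u v : ℝ → Ω → ℝ} {u₀ v₀ : Ω → ℝ}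
    (hb : ∀ᵐ ω ∂P, Continuous fun s => b s ω) (hb2 : ∀ s, MemLp (b s) 2 P)
    (hcov : ∀ s r, 0 ≤ s → 0 ≤ r → ∫ ω, b s ω * b r ω ∂P = σ * min s r)
    (hu₀ : MemLp u₀ 2 P) (hv₀ : MemLp v₀ 2 P)
    (hu : ∀ᵐ ω ∂P, Continuous fun s => u s ω) (hv : ∀ᵐ ω ∂P, Continuous fun s => v s ω)
    (hu' : ∀ᵐ ω ∂P, ∀ t, 0 ≤ t → u t ω = u₀ ω + ∫ s in (0 : ℝ)..t, v s ω)
    (hv' : ∀ᵐ ω ∂P, ∀ t, 0 ≤ t →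
      v t ω = v₀ ω - κ * (∫ s in (0 : ℝ)..t, (u s ω + v s ω)) + b t ω) :
    (∀ t, 0 ≤ t → Integrable (fun ω => u t ω ^ 2) P) ∧
      Tendsto (fun t => ∫ ω, u t ω ^ 2 ∂P) atTop (𝓝 (σ / (2 * κ ^ 2))) := by
  obtain ⟨g, g', hg⟩ := exists_isImpulseResponse κ
  obtain ⟨b', hb'm, hb'⟩ := exists_jointlyMeasurable_modification
    (fun s => (hb2 s).1.aemeasurable) hb
  have hb'ae : ∀ s, b s =ᵐ[P] b' s := fun s => hb'.mono fun ω hω => (hω s).symm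
  have hb'2 : ∀ s, MemLp (b' s) 2 P := fun s => (hb2 s).ae_eq (hb'ae s)
  have hcov' : ∀ s r, 0 ≤ s → 0 ≤ r → ∫ ω, b' s ω * b' r ω ∂P = σ * min s r :=
    fun s r hs hr => by
      rw [← hcov s r hs hr]
      exact integral_congr_ae (hb'.mono fun ω hω => by simp only [hω])
  set I : ℝ → Ω → ℝ := fun t ω => ∫ s in (0 : ℝ)..t, g' (t - s) * b' s ω with hI
  have hI2 : ∀ t, 0 ≤ t → MemLp (I t) 2 P ∧
      ∫ ω, I t ω ^ 2 ∂P = σ * ∫ s in (0 : ℝ)..t, g s ^ 2 := fun t ht => by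
    obtain ⟨h1, h2⟩ := memLp_integral_mul_and_secondMoment hb'm hb'2 hcov'
      (hg.continuous_deriv.comp (continuous_sub_left t)) ht
    refine ⟨h1, h2.trans ?_⟩
    simp only [Function.comp_def, hg.integral_deriv_sub]
    rw [intervalIntegral.integral_comp_sub_left (fun s => g s ^ 2)]
    simp
  set k : ℝ → ℝ := fun t => g' t + κ * g t with hk
  have hueq : ∀ t, 0 ≤ t → u t =ᵐ[P] fun ω => g t * v₀ ω + k t * u₀ ω + I t ω := fun t ht => by
    filter_upwards [hu, hv, hu', hv', hb'] with ω h1 h2 h3 h4 h5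
    simp only [hI, h5]
    exact hg.eq_of_integral_eq h1 h2 h3 h4 ht
  have hmem : ∀ t, 0 ≤ t → MemLp (fun ω => g t * v₀ ω + k t * u₀ ω + I t ω) 2 P := fun t ht =>
    ((hv₀.const_mul (g t)).add (hu₀.const_mul (k t))).add (hI2 t ht).1
  refine ⟨fun t ht => ((hmem t ht).ae_eq (hueq t ht).symm).integrable_sq, ?_⟩
  have hexp : ∀ t, 0 ≤ t → ∫ ω, u t ω ^ 2 ∂P =
      g t ^ 2 * (∫ ω, v₀ ω ^ 2 ∂P) + k t ^ 2 * (∫ ω, u₀ ω ^ 2 ∂P)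
        + 2 * (g t * k t) * (∫ ω, v₀ ω * u₀ ω ∂P)
        + 2 * g t * (∫ ω, v₀ ω * I t ω ∂P) + 2 * k t * (∫ ω, u₀ ω * I t ω ∂P)
        + ∫ ω, I t ω ^ 2 ∂P := fun t ht => by
    have hIt := (hI2 t ht).1
    have e : ∀ ω, (g t * v₀ ω + k t * u₀ ω + I t ω) ^ 2 =
        g t ^ 2 * v₀ ω ^ 2 + k t ^ 2 * u₀ ω ^ 2 + 2 * (g t * k t) * (v₀ ω * u₀ ω)
        + 2 * g t * (v₀ ω * I t ω) + 2 * k t * (u₀ ω * I t ω) + I t ω ^ 2 := fun ω => by ring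
    have i1 := hv₀.integrable_sq.const_mul (g t ^ 2)
    have i2 := hu₀.integrable_sq.const_mul (k t ^ 2)
    have i3 : Integrable (fun ω => 2 * (g t * k t) * (v₀ ω * u₀ ω)) P :=
      (hv₀.integrable_mul hu₀).const_mul _
    have i4 : Integrable (fun ω => 2 * g t * (v₀ ω * I t ω)) P :=
      (hv₀.integrable_mul hIt).const_mul _
    have i5 : Integrable (fun ω => 2 * k t * (u₀ ω * I t ω)) P :=
      (hu₀.integrable_mul hIt).const_mul _
    have hsq : ∫ ω, u t ω ^ 2 ∂P = ∫ ω, (g t * v₀ ω + k t * u₀ ω + I t ω) ^ 2 ∂P :=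
      integral_congr_ae ((hueq t ht).fun_comp (· ^ 2))
    rw [hsq]
    simp only [e]
    refine (integral_add ((((i1.add i2).add i3).add i4).add i5) hIt.integrable_sq).trans ?_
    rw [integral_add' (((i1.add i2).add i3).add i4) i5, integral_add' ((i1.add i2).add i3) i4,
      integral_add' (i1.add i2) i3, integral_add' i1 i2]
    simp only [integral_const_mul]
  have hg0 := hg.tendsto_zero hκ
  have hk0 : Tendsto k atTop (𝓝 0) := by
    simpa using (hg.tendsto_deriv_zero hκ).add (hg0.const_mul κ)
  have hIlim : Tendsto (fun t => ∫ ω, I t ω ^ 2 ∂P) atTop (𝓝 (σ / (2 * κ ^ 2))) := by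
    have := (hg.tendsto_integral_sq hκ).const_mul σ
    rw [mul_one_div] at this
    exact this.congr' ((eventually_ge_atTop 0).mono fun t ht => (hI2 t ht).2.symm)
  -- The initial state may be correlated with the noise, so the cross terms need not vanish; they
  -- tend to zero because their coefficients do while the second moments stay bounded.
  have hcross : ∀ {X : Ω → ℝ} {a : ℝ → ℝ}, MemLp X 2 P → Tendsto a atTop (𝓝 0) →
      Tendsto (fun t => 2 * a t * ∫ ω, X ω * I t ω ∂P) atTop (𝓝 0) := fun {X a} hX ha => by
    have h2 : Tendsto (fun t => |2 * a t| * (∫ ω, X ω ^ 2 ∂P + ∫ ω, I t ω ^ 2 ∂P)) atTop (𝓝 0) := by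
      simpa using (ha.const_mul 2).abs.mul (hIlim.const_add (∫ ω, X ω ^ 2 ∂P))
    refine squeeze_zero_norm' ((eventually_ge_atTop 0).mono fun t ht => ?_) h2
    rw [norm_mul, Real.norm_eq_abs, Real.norm_eq_abs]
    gcongr
    exact abs_integral_mul_le hX (hI2 t ht).1
  have hlim := ((((((hg0.pow 2).mul_const (∫ ω, v₀ ω ^ 2 ∂P)).add
    ((hk0.pow 2).mul_const (∫ ω, u₀ ω ^ 2 ∂P))).add
    (((hg0.mul hk0).const_mul 2).mul_const (∫ ω, v₀ ω * u₀ ω ∂P))).add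
    (hcross hv₀ hg0)).add (hcross hu₀ hk0)).add hIlim
  have h0 : (0 : ℝ) ^ 2 * (∫ ω, v₀ ω ^ 2 ∂P) + 0 ^ 2 * (∫ ω, u₀ ω ^ 2 ∂P)
      + 2 * (0 * 0) * (∫ ω, v₀ ω * u₀ ω ∂P) + 0 + 0 + σ / (2 * κ ^ 2) = σ / (2 * κ ^ 2) := by ring
  rw [h0] at hlim
  exact hlim.congr' ((eventually_ge_atTop 0).mono fun t ht => (hexp t ht).symm)

theorem integral_brownian_mul {V Ω : Type*} [DecidableEq V] [MeasurableSpace Ω] {P : Measure Ω}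
    [IsProbabilityMeasure P] {W : V → ℝ≥0 → Ω → ℝ} (hW : ∀ j, IsBrownianReal (W j) P)
    (hind : iIndepFun (fun j ω t => W j t ω) P) (i j : V) (s r : ℝ≥0) :
    ∫ ω, W i s ω * W j r ω ∂P = if i = j then (min s r : ℝ) else 0 := by
  have hL : ∀ j s, MemLp (W j s) 2 P := fun j s =>
    ((hW j).hasLaw_eval s).hasGaussianLaw.memLp_two
  have h := covariance_eq_sub (hL i s) (hL j r)
  rw [(hW i).integral_eval, zero_mul, sub_zero] at h
  refine h.symm.trans ?_
  split_ifs with hij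
  · subst hij
    simpa using (hW i).covariance_eval s r
  · exact ((hind.indepFun hij).comp (measurable_pi_apply s) (measurable_pi_apply r)
      ).covariance_eq_zero (hL i s) (hL j r)

/-- Uniqueness of the Moore–Penrose pseudo-inverse. -/
theorem eq_of_penrose {V : Type*} [Fintype V] {A X Y : Matrix V V ℝ}
    (hX : A * X * A = A ∧ X * A * X = X ∧ (A * X)ᵀ = A * X ∧ (X * A)ᵀ = X * A)
    (hY : A * Y * A = A ∧ Y * A * Y = Y ∧ (A * Y)ᵀ = A * Y ∧ (Y * A)ᵀ = Y * A) : X = Y := by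
  obtain ⟨x1, x2, x3, x4⟩ := hX
  obtain ⟨y1, y2, y3, y4⟩ := hY
  have h1 : A * X = A * Y := by
    calc A * X = (A * Y * A) * X := by rw [y1]
      _ = (A * Y)ᵀ * (A * X)ᵀ := by rw [y3, x3, Matrix.mul_assoc]
      _ = (A * X * A * Y)ᵀ := by rw [← Matrix.transpose_mul]; simp only [Matrix.mul_assoc]
      _ = A * Y := by rw [x1, y3]
  have h2 : X * A = Y * A := by
    calc X * A = X * (A * Y * A) := by rw [y1]
      _ = (X * A)ᵀ * (Y * A)ᵀ := by rw [y4, x4]; simp only [Matrix.mul_assoc]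
      _ = (Y * (A * X * A))ᵀ := by rw [← Matrix.transpose_mul]; simp only [Matrix.mul_assoc]
      _ = Y * A := by rw [x1, y4]
  calc X = X * (A * X) := by rw [← Matrix.mul_assoc, x2]
    _ = (X * A) * Y := by rw [h1, Matrix.mul_assoc]
    _ = Y := by rw [h2, y2]

/-! ### The complete graph: reduction to one mode, pseudo-inverse, variances. -/

section Complete

variable {V : Type*} [Fintype V] [DecidableEq V]

/-- A weight vector with zero sum is an eigenvector of the Laplacian of the complete graph. -/
theorem sum_mul_lapMatrix_top_mulVec {c : V → ℝ} (hc : ∑ j, c j = 0) (x : V → ℝ) :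
    ∑ j, c j * ((⊤ : SimpleGraph V).lapMatrix ℝ *ᵥ x) j = Fintype.card V * ∑ j, c j * x j := by
  have h : ∀ j, ((⊤ : SimpleGraph V).lapMatrix ℝ *ᵥ x) j = Fintype.card V * x j - ∑ k, x k :=
    fun j => by
      have h1 : (Finset.univ.erase j).sum x + x j = ∑ k, x k :=
        Finset.sum_erase_add _ _ (Finset.mem_univ j)
      have h2 : (⊤ : SimpleGraph V).neighborFinset j = Finset.univ.erase j := by
        ext k; simp [eq_comm]
      have h3 : 1 ≤ Fintype.card V := Fintype.card_pos_iff.2 ⟨j⟩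
      rw [SimpleGraph.lapMatrix_mulVec_apply, h2, SimpleGraph.complete_graph_degree,
        Nat.cast_sub h3]
      push_cast
      linarith
  simp only [h, mul_sub, Finset.sum_sub_distrib, ← Finset.sum_mul, hc, zero_mul, sub_zero]
  rw [Finset.mul_sum]
  exact Finset.sum_congr rfl fun j _ => by ring

/-- The stationary variance of a linear observable of the positions that vanishes on
consensus states. -/
theorem IsConsensusSolution.tendsto_secondMoment [Nonempty V] {Ω : Type*} [MeasurableSpace Ω]
    {P : Measure Ω} [IsProbabilityMeasure P] {W : V → ℝ≥0 → Ω → ℝ} {x₁ x₂ : ℝ≥0 → Ω → V → ℝ}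
    (h : IsConsensusSolution (⊤ : SimpleGraph V) P W x₁ x₂) {c : V → ℝ} (hc : ∑ j, c j = 0) :
    (∀ t, Integrable (fun ω => (∑ j, c j * x₁ t ω j) ^ 2) P) ∧
      Tendsto (fun t => ∫ ω, (∑ j, c j * x₁ t ω j) ^ 2 ∂P) atTop
        (𝓝 ((∑ j, c j ^ 2) / (2 * (Fintype.card V : ℝ) ^ 2))) := by
  have hκ : (0 : ℝ) < Fintype.card V := by exact_mod_cast Fintype.card_pos
  have hL : ∀ j s, MemLp (W j s) 2 P := fun j s =>
    ((h.brownian j).hasLaw_eval s).hasGaussianLaw.memLp_two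
  obtain ⟨hint, hlim⟩ := tendsto_secondMoment_oscillator (P := P) (κ := Fintype.card V)
    (σ := ∑ j, c j ^ 2) hκ
    (b := fun s ω => ∑ j, c j * W j s.toNNReal ω)
    (u := fun s ω => ∑ j, c j * x₁ s.toNNReal ω j)
    (v := fun s ω => ∑ j, c j * x₂ s.toNNReal ω j)
    (u₀ := fun ω => ∑ j, c j * x₁ 0 ω j) (v₀ := fun ω => ∑ j, c j * x₂ 0 ω j)
    (by
      filter_upwards [ae_all_iff.2 fun j => (h.brownian j).cont] with ω hω
      exact continuous_finsetSum _ fun j _ =>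
        continuous_const.mul ((hω j).comp continuous_real_toNNReal))
    (fun s => memLp_finsetSum _ fun j _ => (hL j _).const_mul (c j))
    (fun s r hs hr => by
      have e : ∀ ω, (∑ j, c j * W j s.toNNReal ω) * (∑ j, c j * W j r.toNNReal ω) =
          ∑ i, ∑ j, c i * c j * (W i s.toNNReal ω * W j r.toNNReal ω) := fun ω => by
        rw [Finset.sum_mul_sum]
        exact Finset.sum_congr rfl fun i _ => Finset.sum_congr rfl fun j _ => by ring
      have hi : ∀ i j, Integrable
          (fun ω => c i * c j * (W i s.toNNReal ω * W j r.toNNReal ω)) P := fun i j =>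
        ((hL i _).integrable_mul (hL j _)).const_mul _
      simp only [e]
      rw [integral_finsetSum _ fun i _ => integrable_finsetSum _ fun j _ => hi i j]
      rw [Finset.sum_mul]
      refine Finset.sum_congr rfl fun i _ => ?_
      rw [integral_finsetSum _ fun j _ => hi i j]
      simp only [integral_const_mul, integral_brownian_mul h.brownian h.indep, mul_ite, mul_zero,
        Finset.sum_ite_eq, Finset.mem_univ, if_true, Real.coe_toNNReal _ hs,
        Real.coe_toNNReal _ hr]
      ring)
    (memLp_finsetSum _ fun j _ => (h.memLp_init₁ j).const_mul (c j))
    (memLp_finsetSum _ fun j _ => (h.memLp_init₂ j).const_mul (c j))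
    (by
      filter_upwards [h.continuous₁] with ω hω
      have := hω.comp continuous_real_toNNReal
      exact continuous_finsetSum _ fun j _ =>
        continuous_const.mul ((continuous_apply j).comp this))
    (by
      filter_upwards [h.continuous₂] with ω hω
      have := hω.comp continuous_real_toNNReal
      exact continuous_finsetSum _ fun j _ =>
        continuous_const.mul ((continuous_apply j).comp this))
    (by
      filter_upwards [h.eq₁, h.continuous₂] with ω hω hc2 t ht
      have hcont : ∀ j, Continuous fun s : ℝ => x₂ s.toNNReal ω j := fun j =>
        (continuous_apply j).comp (hc2.comp continuous_real_toNNReal)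
      rw [intervalIntegral.integral_finsetSum fun j _ =>
        ((hcont j).intervalIntegrable _ _).const_mul _, ← Finset.sum_add_distrib]
      refine Finset.sum_congr rfl fun j _ => ?_
      rw [hω t.toNNReal j, Real.coe_toNNReal _ ht, intervalIntegral.integral_const_mul, mul_add])
    (by
      filter_upwards [h.eq₂, h.continuous₁, h.continuous₂] with ω hω hc1 hc2 t ht
      have hcont : ∀ j, Continuous fun s : ℝ =>
          -((⊤ : SimpleGraph V).lapMatrix ℝ *ᵥ x₁ s.toNNReal ω) j
            - ((⊤ : SimpleGraph V).lapMatrix ℝ *ᵥ x₂ s.toNNReal ω) j := fun j => by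
        have h1 := hc1.comp continuous_real_toNNReal
        have h2 := hc2.comp continuous_real_toNNReal
        exact (((continuous_apply j).comp (continuous_const.matrix_mulVec h1)).neg).sub
          ((continuous_apply j).comp (continuous_const.matrix_mulVec h2))
      have e : ∀ s : ℝ, ∑ j, c j * (-((⊤ : SimpleGraph V).lapMatrix ℝ *ᵥ x₁ s.toNNReal ω) j
            - ((⊤ : SimpleGraph V).lapMatrix ℝ *ᵥ x₂ s.toNNReal ω) j) =
          -(Fintype.card V * (∑ j, c j * x₁ s.toNNReal ω j + ∑ j, c j * x₂ s.toNNReal ω j)) :=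
        fun s => by
          simp only [mul_sub, mul_neg, Finset.sum_sub_distrib, Finset.sum_neg_distrib,
            sum_mul_lapMatrix_top_mulVec hc]
          ring
      have e2 : ∑ j, c j * (∫ s in (0 : ℝ)..t,
          (-((⊤ : SimpleGraph V).lapMatrix ℝ *ᵥ x₁ s.toNNReal ω) j
            - ((⊤ : SimpleGraph V).lapMatrix ℝ *ᵥ x₂ s.toNNReal ω) j)) =
          -(Fintype.card V * ∫ s in (0 : ℝ)..t,
            (∑ j, c j * x₁ s.toNNReal ω j + ∑ j, c j * x₂ s.toNNReal ω j)) := by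
        rw [← intervalIntegral.integral_const_mul, ← intervalIntegral.integral_neg]
        simp only [← e]
        rw [intervalIntegral.integral_finsetSum fun j _ =>
          ((hcont j).intervalIntegrable _ _).const_mul _]
        simp only [intervalIntegral.integral_const_mul]
      have e3 : ∀ j, x₂ t.toNNReal ω j = _ := fun j => hω t.toNNReal j
      simp only [Real.coe_toNNReal _ ht] at e3
      simp only [e3, mul_add, Finset.sum_add_distrib, e2]
      simp only [← Finset.sum_add_distrib, ← mul_add]
      ring)
  refine ⟨fun t => ?_, ?_⟩
  · simpa using hint t t.2
  · simpa [Function.comp_def] using hlim.comp (NNReal.tendsto_coe_atTop.2 tendsto_id)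

theorem lapMatrix_top_apply (i j : V) :
    (⊤ : SimpleGraph V).lapMatrix ℝ i j = (if i = j then (Fintype.card V : ℝ) else 0) - 1 := by
  have h3 : 1 ≤ Fintype.card V := Fintype.card_pos_iff.2 ⟨i⟩
  by_cases hij : i = j
  · subst hij
    simp [SimpleGraph.lapMatrix, SimpleGraph.degMatrix, Nat.cast_sub h3]
  · simp [SimpleGraph.lapMatrix, SimpleGraph.degMatrix, hij]

theorem lapMatrix_top_mul_self :
    (⊤ : SimpleGraph V).lapMatrix ℝ * (⊤ : SimpleGraph V).lapMatrix ℝ =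
      (Fintype.card V : ℝ) • (⊤ : SimpleGraph V).lapMatrix ℝ := by
  ext i j
  simp only [Matrix.mul_apply, lapMatrix_top_apply, sub_mul, mul_sub, ite_mul, mul_ite,
    Finset.sum_sub_distrib, Finset.sum_ite_eq, Finset.sum_ite_eq', Finset.mem_univ, if_true,
    Matrix.smul_apply, smul_eq_mul, zero_mul, mul_zero, one_mul, mul_one, Finset.sum_const,
    Finset.card_univ, nsmul_eq_mul]
  ring

/-- From `L² = N L`, the symmetric matrix `X = L / N²` satisfies `L X L = L³ / N² = L` and `X L X =
X`; uniqueness of the pseudo-inverse concludes. -/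
theorem pinv_lapMatrix_top [Nonempty V] :
    pinv ((⊤ : SimpleGraph V).isHermitian_lapMatrix ℝ) =
      ((Fintype.card V : ℝ) ^ 2)⁻¹ • (⊤ : SimpleGraph V).lapMatrix ℝ := by
  have hN : (Fintype.card V : ℝ) ≠ 0 := by exact_mod_cast Fintype.card_ne_zero
  refine eq_of_penrose (pinv_penrose _) ?_
  have hT : ((⊤ : SimpleGraph V).lapMatrix ℝ)ᵀ = (⊤ : SimpleGraph V).lapMatrix ℝ :=
    (⊤ : SimpleGraph V).isSymm_lapMatrix ℝ
  simp only [Matrix.mul_smul, Matrix.smul_mul, lapMatrix_top_mul_self, smul_smul,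
    Matrix.transpose_smul, hT, and_true]
  constructor
  · convert one_smul ℝ _ using 2
    field_simp
  · congr 1
    field_simp

theorem biharmonicDist_top [Nonempty V] {j k : V} (hjk : j ≠ k) :
    biharmonicDist (⊤ : SimpleGraph V) j k = Real.sqrt 2 / Fintype.card V := by
  have hN : (0 : ℝ) < Fintype.card V := by exact_mod_cast Fintype.card_pos
  simp only [biharmonicDist, pinv_lapMatrix_top, sq, Matrix.mul_smul, Matrix.smul_mul,
    lapMatrix_top_mul_self, smul_smul, Matrix.smul_apply, lapMatrix_top_apply, hjk, if_true,
    if_false, smul_eq_mul]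
  rw [← Real.sqrt_sq hN.le, ← Real.sqrt_div zero_le_two, Real.sqrt_sq hN.le]
  congr 1
  field_simp
  ring

variable [Nonempty V] {Ω : Type*} [MeasurableSpace Ω] {P : Measure Ω} [IsProbabilityMeasure P]
  {W : V → ℝ≥0 → Ω → ℝ} {x₁ x₂ : ℝ≥0 → Ω → V → ℝ}

theorem IsConsensusSolution.hasPairwiseVariance
    (h : IsConsensusSolution (⊤ : SimpleGraph V) P W x₁ x₂) {j k : V} (hjk : j ≠ k) :
    HasPairwiseVariance P x₁ j k (1 / (Fintype.card V : ℝ) ^ 2) := by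
  set c : V → ℝ := fun i => (if i = j then 1 else 0) - (if i = k then 1 else 0) with hc
  have hN : (0 : ℝ) < Fintype.card V := by exact_mod_cast Fintype.card_pos
  have hx : ∀ x : V → ℝ, ∑ i, c i * x i = x j - x k := fun x => by
    simp [hc, sub_mul, Finset.sum_sub_distrib]
  have hc2 : ∑ i, c i ^ 2 = 2 := by
    -- `|c|²` is the observable evaluated at `c` itself, namely `c j - c k = 2`.
    simp only [sq, hx c]
    simp only [hc, hjk, hjk.symm, if_true, if_false]
    norm_num
  have := h.tendsto_secondMoment (c := c) (by simpa using hx fun _ => 1)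
  simp only [hx, hc2] at this
  refine ⟨this.1, ?_⟩
  convert this.2 using 2
  field_simp

theorem IsConsensusSolution.hasVertexVariance
    (h : IsConsensusSolution (⊤ : SimpleGraph V) P W x₁ x₂) (j : V) :
    HasVertexVariance P x₁ j
      (((Fintype.card V : ℝ) - 1) / (2 * (Fintype.card V : ℝ) ^ 3)) := by
  set c : V → ℝ := fun i => (if i = j then 1 else 0) - 1 / (Fintype.card V : ℝ) with hc
  have hN : (0 : ℝ) < Fintype.card V := by exact_mod_cast Fintype.card_pos
  have hx : ∀ x : V → ℝ, ∑ i, c i * x i = x j - avg x := fun x => by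
    simp [hc, sub_mul, Finset.sum_sub_distrib, avg, Finset.mul_sum]
  have hc0 : ∑ i, c i = 0 := by
    simp [hc, Finset.sum_sub_distrib, hN.ne']
  have hc2 : ∑ i, c i ^ 2 = ((Fintype.card V : ℝ) - 1) / Fintype.card V := by
    -- Again `|c|²` is the observable at `c`: `c j - avg c = 1 - 1 / N`, because `c` has zero
    -- average.
    simp only [sq, hx c, avg, hc0]
    simp only [hc, if_true]
    field_simp
    ring
  have := h.tendsto_secondMoment hc0
  simp only [hx, hc2] at this
  refine ⟨this.1, ?_⟩
  convert this.2 using 2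
  field_simp

theorem IsConsensusSolution.hasTotalVariance
    (h : IsConsensusSolution (⊤ : SimpleGraph V) P W x₁ x₂) :
    HasTotalVariance P x₁ (((Fintype.card V : ℝ) - 1) / (2 * (Fintype.card V : ℝ) ^ 2)) := by
  have hN : (0 : ℝ) < Fintype.card V := by exact_mod_cast Fintype.card_pos
  refine ⟨fun t j => (h.hasVertexVariance j).1 t, ?_⟩
  convert tendsto_finsetSum Finset.univ fun j _ => (h.hasVertexVariance j).2 using 2
  simp only [Finset.sum_const, Finset.card_univ, nsmul_eq_mul]
  field_simp

end Complete

end SecondOrderConsensus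

theorem mainTheorem12 {V : Type*} [Fintype V] [DecidableEq V] [Nonempty V]
    (N : ℕ) (hN : Fintype.card V = N) :
    (∀ j k : V, j ≠ k →
      SecondOrderConsensus.biharmonicDist (⊤ : SimpleGraph V) j k = Real.sqrt 2 / N) ∧
    (∀ {Ω : Type*} [MeasurableSpace Ω] (P : Measure Ω) [IsProbabilityMeasure P]
        (W : V → ℝ≥0 → Ω → ℝ) (x₁ x₂ : ℝ≥0 → Ω → V → ℝ),
      SecondOrderConsensus.IsConsensusSolution (⊤ : SimpleGraph V) P W x₁ x₂ →
        (∀ j k : V, j ≠ k →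
          SecondOrderConsensus.HasPairwiseVariance P x₁ j k (1 / (N : ℝ) ^ 2)) ∧
        (∀ j : V,
          SecondOrderConsensus.HasVertexVariance P x₁ j (((N : ℝ) - 1) / (2 * (N : ℝ) ^ 3))) ∧
        SecondOrderConsensus.HasTotalVariance P x₁ (((N : ℝ) - 1) / (2 * (N : ℝ) ^ 2))) := by
  subst hN
  exact ⟨fun j k hjk => SecondOrderConsensus.biharmonicDist_top hjk, fun P _ W x₁ x₂ h =>
    ⟨fun j k hjk => h.hasPairwiseVariance hjk, h.hasVertexVariance, h.hasTotalVariance⟩⟩
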